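/- Let $X$ be the following infinite 2-dimensional CW-complex. Its 0-cells are points $e_n^0$, $n\geq 0$; call $x=e_0^0$ the origin. The 1-skeleton $X^1$ is formed by connecting the origin, for each $n\geq 1$, to $e_n^0$ with two 1-cells $e_n^1$ and $e_{-n}^1$. Finally, for each $n\geq 1$ choose a homeomorphism $$\varphi_n:S^1\longrightarrow e_0^0\cup e_n^0\cup e_n^1\cup e_{-n}^1\subset X^1$$ and attach a 2-cell $e_n^2$ along $\varphi_n$; the closed 2-cell $\overline{e_n^2}$ is the image of the closed disk $D^2$ in $X$. Let $X_{\rm crs}$ be the set $X$ endowed with the coarser topology in which a subset $U$ is open if and only if it is open in the CW-topology and either $x\notin U$, or $\overline{e_n^2}\smallsetminus e_n^0\subset U$ for all but finitely many $n\geq 1$. Let $\mathcal{C}$ be the sheaf of continuous real-valued functions on $X_{\rm crs}$. An abelian sheaf $\mathcal{F}$ on a topological space $Y$ is called soft if for every closed subset $A\subset Y$, with inclusion $i:A\to Y$, the canonical map $H^0(Y,\mathcal{F})\to H^0(A,i^{-1}\mathcal{F})$ is surjective, and acyclic if $H^p(Y,\mathcal{F})=0$ for all $p>0$, where $H^p$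 denotes sheaf cohomology. Proposition. For every choice of the homeomorphisms $\varphi_n$, we have $H^1(X_{\rm crs},\mathcal{C})\neq 0$, and the sheaf $\mathcal{C}$ is neither soft nor acyclic. -/

import Mathlib

open CategoryTheory TopologicalSpace Opposite

namespace CoarseCW

/-! ### The 1-skeleton -/

/-- The disjoint union of the 0-cells, indexed by `ℕ`, and of closed intervals, one for each
1-cell. The 1-cells are indexed by `ℕ+ × Bool`: for every `n ≥ 1` there are two of them. -/
abbrev PreOneSkeleton : Type := ℕ ⊕ (Σ _ : ℕ+ × Bool, unitInterval)

/-- The 1-cells with index `n` join the 0-cell `0` to the 0-cell `n`. -/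
inductive EdgeGlue : PreOneSkeleton → PreOneSkeleton → Prop
  | source (k : ℕ+ × Bool) : EdgeGlue (Sum.inr ⟨k, 0⟩) (Sum.inl 0)
  | target (k : ℕ+ × Bool) : EdgeGlue (Sum.inr ⟨k, 1⟩) (Sum.inl (k.1 : ℕ))

/-- The 1-skeleton `X¹`, with the quotient topology. -/
def OneSkeleton : Type := Quot EdgeGlue

instance : TopologicalSpace OneSkeleton :=
  inferInstanceAs (TopologicalSpace (Quot EdgeGlue))

/-- The 0-cell `eₙ⁰` in the 1-skeleton. -/
def OneSkeleton.vertex (n : ℕ) : OneSkeleton := Quot.mk _ (Sum.inl n)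

/-- The points of the closed 1-cells; `b : Bool` distinguishes the two 1-cells with index `n`. -/
def OneSkeleton.edge (n : ℕ+) (b : Bool) (t : unitInterval) : OneSkeleton :=
  Quot.mk _ (Sum.inr ⟨(n, b), t⟩)

/-- The subspace `e₀⁰ ∪ eₙ⁰ ∪ eₙ¹ ∪ e₋ₙ¹` of the 1-skeleton. -/
def loop (n : ℕ+) : Set OneSkeleton :=
  {OneSkeleton.vertex 0, OneSkeleton.vertex n} ∪
    (Set.range (OneSkeleton.edge n true) ∪ Set.range (OneSkeleton.edge n false))

/-- A choice of the attaching maps of the 2-cells: homeomorphisms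
`φₙ : S¹ → e₀⁰ ∪ eₙ⁰ ∪ eₙ¹ ∪ e₋ₙ¹`, one for each `n ≥ 1`. -/
abbrev AttachingMaps : Type := ∀ n : ℕ+, Circle ≃ₜ loop n

/-! ### The CW-complex -/

/-- The closed unit disk `D²`. -/
abbrev Disk : Type := Metric.closedBall (0 : ℂ) 1

/-- The boundary inclusion `S¹ → D²`. -/
def Disk.ofCircle (z : Circle) : Disk := ⟨(z : ℂ), by simp [Circle.norm_coe]⟩

/-- The disjoint union of the 1-skeleton and of closed disks `D²`, one for each `n ≥ 1`. -/
abbrev PreCW : Type := OneSkeleton ⊕ (Σ _ : ℕ+, Disk)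

/-- The boundary of the `n`-th disk is glued to the 1-skeleton along `φₙ`. -/
inductive DiskGlue (φ : AttachingMaps) : PreCW → PreCW → Prop
  | glue (n : ℕ+) (z : Circle) :
      DiskGlue φ (Sum.inr ⟨n, Disk.ofCircle z⟩) (Sum.inl (φ n z : OneSkeleton))

/-- The infinite 2-dimensional CW-complex `X`, with its CW-topology (the quotient topology). -/
def CW (φ : AttachingMaps) : Type := Quot (DiskGlue φ)

instance (φ : AttachingMaps) : TopologicalSpace (CW φ) :=
  inferInstanceAs (TopologicalSpace (Quot (DiskGlue φ)))

/-- The 0-cell `eₙ⁰` of `X`. -/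
def vertex (φ : AttachingMaps) (n : ℕ) : CW φ :=
  Quot.mk _ (Sum.inl (OneSkeleton.vertex n))

/-- The origin `x = e₀⁰`. -/
def origin (φ : AttachingMaps) : CW φ := vertex φ 0

/-- The characteristic map `D² → X` of the `n`-th 2-cell. -/
def diskMap (φ : AttachingMaps) (n : ℕ+) (z : Disk) : CW φ :=
  Quot.mk _ (Sum.inr ⟨n, z⟩)

/-- The `n`-th closed 2-cell, that is, the closure of `eₙ²`: the image of the closed disk. -/
def closedCell (φ : AttachingMaps) (n : ℕ+) : Set (CW φ) := Set.range (diskMap φ n)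

/-! ### The coarser topology -/

/-- The open sets of the coarser topology: the sets that are open in the CW-topology and either do
not contain the origin, or contain the closed 2-cell with index `n`, with the 0-cell `eₙ⁰`
removed, for all but finitely many `n`. -/
def IsCoarseOpen (φ : AttachingMaps) (U : Set (CW φ)) : Prop :=
  IsOpen U ∧ (origin φ ∉ U ∨ {n : ℕ+ | ¬ closedCell φ n \ {vertex φ n} ⊆ U}.Finite)

/-- The coarser topology on `X`. -/
@[reducible] def coarseTopology (φ : AttachingMaps) : TopologicalSpace (CW φ) where
  IsOpen U := IsCoarseOpen φ U
  isOpen_univ := ⟨isOpen_univ, Or.inr (by simp)⟩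
  isOpen_inter U V hU hV := by
    refine ⟨hU.1.inter hV.1, ?_⟩
    rcases hU.2 with h | h
    · exact Or.inl fun hx => h hx.1
    rcases hV.2 with h' | h'
    · exact Or.inl fun hx => h' hx.2
    refine Or.inr ((h.union h').subset fun n hn => ?_)
    by_contra hc
    simp only [Set.mem_union, Set.mem_ofPred_eq, not_or, not_not] at hc
    exact hn (Set.subset_inter hc.1 hc.2)
  isOpen_sUnion S hS := by
    refine ⟨isOpen_sUnion fun U hU => (hS U hU).1, ?_⟩
    by_cases hx : ∃ U ∈ S, origin φ ∈ U
    · obtain ⟨U, hU, hxU⟩ := hx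
      rcases (hS U hU).2 with h | h
      · exact absurd hxU h
      exact Or.inr (h.subset fun n hn hc => hn (hc.trans (Set.subset_sUnion_of_mem hU)))
    · push Not at hx
      exact Or.inl fun ⟨U, hU, hxU⟩ => hx U hU hxU

/-- The set `X`, endowed with the coarser topology. -/
def Crs (φ : AttachingMaps) : Type := CW φ

instance (φ : AttachingMaps) : TopologicalSpace (Crs φ) := coarseTopology φ

/-! ### Sheaves -/

/-- The presheaf of abelian groups `U ↦ C(U, ℝ)` on a topological space. -/
def contPresheaf (Y : TopCat.{0}) : TopCat.Presheaf AddCommGrpCat.{0} Y where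
  obj U := AddCommGrpCat.of C(U.unop, ℝ)
  map {U V} i := AddCommGrpCat.ofHom
    (ContinuousMap.compAddMonoidHom' (⟨Set.inclusion i.unop.le, continuous_inclusion i.unop.le⟩ :
      C(V.unop, U.unop)))
  map_id _ := rfl
  map_comp _ _ := rfl

theorem contPresheaf_isSheaf (Y : TopCat.{0}) : (contPresheaf Y).IsSheaf := by
  rw [TopCat.Presheaf.isSheaf_iff_isSheaf_comp (forget AddCommGrpCat.{0})]
  refine TopCat.Presheaf.isSheaf_of_iso ?_ (TopCat.sheafToTop (X := Y) (TopCat.of ℝ)).2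
  exact NatIso.ofComponents
    (fun U => { hom := ↾fun f => f.hom, inv := ↾fun f => TopCat.ofHom f })
    (fun _ => rfl)

/-- The sheaf of continuous real-valued functions on a topological space. -/
def contSheaf (Y : TopCat.{0}) : TopCat.Sheaf AddCommGrpCat.{0} Y :=
  ⟨contPresheaf Y, contPresheaf_isSheaf Y⟩

/-- The sheaf cohomology group `Hᵖ(Y, F)` of an abelian sheaf. -/
noncomputable abbrev cohomology {Y : TopCat.{0}} (F : TopCat.Sheaf AddCommGrpCat.{0} Y)
    (p : ℕ) : Type :=
  CategoryTheory.Sheaf.H (J := Opens.grothendieckTopology Y) F p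

/-- An abelian sheaf is acyclic if its cohomology vanishes in all positive degrees. -/
def IsAcyclic {Y : TopCat.{0}} (F : TopCat.Sheaf AddCommGrpCat.{0} Y) : Prop :=
  ∀ p : ℕ, 0 < p → Subsingleton (cohomology F p)

/-- For `i : A ⟶ Y`, the canonical map `H⁰(Y, F) ⟶ H⁰(A, i⁻¹F)`. -/
noncomputable def restrictionMap {A Y : TopCat.{0}} (i : A ⟶ Y)
    (F : TopCat.Sheaf AddCommGrpCat.{0} Y) :
    F.presheaf.obj (op ⊤) ⟶
      ((TopCat.Sheaf.pullback AddCommGrpCat.{0} i).obj F).presheaf.obj (op ⊤) :=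
  ((TopCat.Sheaf.pullbackPushforwardAdjunction AddCommGrpCat.{0} i).unit.app F).hom.app (op ⊤)

/-- An abelian sheaf `F` on `Y` is soft if `H⁰(Y, F) ⟶ H⁰(A, i⁻¹F)` is surjective for every closed
subset `A` of `Y`, with inclusion map `i : A ⟶ Y`. -/
def IsSoft {Y : TopCat.{0}} (F : TopCat.Sheaf AddCommGrpCat.{0} Y) : Prop :=
  ∀ A : Set Y, IsClosed A →
    Function.Surjective
      (restrictionMap (TopCat.ofHom (⟨Subtype.val, continuous_subtype_val⟩ : C(A, Y))) F)

end CoarseCW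

/-!
The height `h` on `X` vanishes at the origin, is the parameter along each 1-cell, and is extended
over the 2-cells so that `h = 1` exactly at the 0-cells `eₙ⁰` with `n ≥ 1` (`exists_height`). The
sets `U = {h < 1}` and `V = {h > 1/2}` are open for the coarser topology and cover `X`
(`exists_cover`). The first contains the origin and the second does not.

A continuous function `u` on `U` differs from its value at the origin by less than `ε` on almost all
punctured closed cells, since the set where this holds is an open neighbourhood of the origin
(`exists_forall_abs_sub_lt`). Hence, for some `n`, it is bounded along a 1-cell that ends at `eₙ⁰`.

* The function `1 / (1 - h)` is continuous on `U ∩ V` and tends to infinity along that 1-cell. It is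
  therefore not of the form `u - v` with `v` continuous on `V`, because `v` is bounded near `eₙ⁰`.
  By the Mayer–Vietoris sequence (`exists_sub_of_subsingleton_H_one`), it has nonzero image in `H¹`.
* The complement `A` of `U ∩ V` is closed and is the disjoint union of its open subsets `U ∩ A` and
  `V ∩ A`, so there is a section over `A` equal to `0` on `U ∩ A` and to `1` on `V ∩ A`. An
  extension to `X` would be `0` at the origin, hence close to `0` along some 1-cell ending at `eₙ⁰`,
  but `1` at `eₙ⁰` itself (`exists_extension_of_isSoft`, `not_isSoft`).
-/

namespace CoarseCW

/-! ### Sheaf cohomology and Mayer–Vietoris squares -/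

open Limits in
theorem biprod_lift_neg_comp {D : Type*} [Category* D] [Preadditive D]
    [Limits.HasBinaryBiproducts D] {W A B Z : D} (a : W ⟶ A) (b : W ⟶ B) (k : A ⊞ B ⟶ Z) :
    biprod.lift a (-b) ≫ k = a ≫ biprod.inl ≫ k - b ≫ biprod.inr ≫ k := by
  rw [biprod.lift_eq, Preadditive.add_comp, Preadditive.neg_comp, Preadditive.neg_comp,
    Category.assoc, Category.assoc, sub_eq_add_neg]

section Site

universe w v u

variable {C : Type u} [Category.{v} C]

/-- The free abelian presheaf on a final presheaf `yoneda.obj T` is constant with value `ℤ`. -/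
noncomputable def freeYonedaTerminalIso {T : C} (hT : Limits.IsTerminal T) :
    yoneda.obj T ⋙ AddCommGrpCat.free.{v} ≅
      (Functor.const Cᵒᵖ).obj (AddCommGrpCat.of (ULift.{v} ℤ)) :=
  NatIso.ofComponents
    (fun W =>
      letI : Unique (W.unop ⟶ T) := ⟨⟨hT.from _⟩, fun _ => hT.hom_ext _ _⟩
      AddEquiv.toAddCommGrpIso
        ((FreeAbelianGroup.uniqueEquiv (W.unop ⟶ T)).trans AddEquiv.ulift.symm))
    (fun {W W'} i => by
      refine AddCommGrpCat.hom_ext (FreeAbelianGroup.lift_ext _ _ fun x => ?_)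
      refine congrArg ULift.up (?_ : FreeAbelianGroup.lift (fun _ => (1 : ℤ))
        (FreeAbelianGroup.map (fun g => i.unop ≫ g) (FreeAbelianGroup.of x)) =
          FreeAbelianGroup.lift (fun _ => (1 : ℤ)) (FreeAbelianGroup.of x))
      rw [FreeAbelianGroup.map_of_apply, FreeAbelianGroup.lift_apply_of,
        FreeAbelianGroup.lift_apply_of])

variable {J : GrothendieckTopology C} [HasSheafify J AddCommGrpCat.{v}]

/-- The abelian sheaf freely generated by an object `W` corepresents the functor of sections
over `W`. -/
noncomputable def freeYonedaHomEquiv (W : C) (F : Sheaf J AddCommGrpCat.{v}) :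
    ((presheafToSheaf J AddCommGrpCat.{v}).obj (yoneda.obj W ⋙ AddCommGrpCat.free) ⟶ F) ≃
      F.obj.obj (op W) :=
  ((sheafificationAdjunction _ _).homEquiv _ _).trans
    (((AddCommGrpCat.adj.whiskerRight _).homEquiv _ _).trans yonedaEquiv)

theorem freeYonedaHomEquiv_comp {W W' : C} (i : W ⟶ W') (F : Sheaf J AddCommGrpCat.{v})
    (g : (presheafToSheaf J AddCommGrpCat.{v}).obj (yoneda.obj W' ⋙ AddCommGrpCat.free) ⟶ F) :
    freeYonedaHomEquiv W F
      ((presheafToSheaf _ _).map (Functor.whiskerRight (yoneda.map i) AddCommGrpCat.free) ≫ g) =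
      F.obj.map i.op (freeYonedaHomEquiv W' F g) := by
  dsimp only [freeYonedaHomEquiv, Equiv.trans_apply]
  rw [Adjunction.homEquiv_naturality_left]
  have := (AddCommGrpCat.adj.whiskerRight Cᵒᵖ).homEquiv_naturality_left (yoneda.map i)
    ((sheafificationAdjunction J AddCommGrpCat).homEquiv _ F g)
  refine (congrArg yonedaEquiv this).trans ?_
  exact (yonedaEquiv_naturality _ _).symm

theorem freeYonedaHomEquiv_add {W : C} (F : Sheaf J AddCommGrpCat.{v})
    (g g' : (presheafToSheaf J AddCommGrpCat.{v}).obj (yoneda.obj W ⋙ AddCommGrpCat.free) ⟶ F) :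
    freeYonedaHomEquiv W F (g + g') = freeYonedaHomEquiv W F g + freeYonedaHomEquiv W F g' := by
  simp [freeYonedaHomEquiv, Adjunction.homEquiv]
  rfl

open Abelian in
/-- One exactness step of the Mayer–Vietoris sequence: if `H¹(X₄, F)` vanishes, then every section
over `X₁` is a difference of sections over `X₂` and over `X₃`. -/
theorem exists_sub_of_subsingleton_H_one [HasWeakSheafify J (Type v)]
    [HasExt.{w} (Sheaf J AddCommGrpCat.{v})]
    (S : J.MayerVietorisSquare) (hS : Limits.IsTerminal S.X₄)
    (F : Sheaf J AddCommGrpCat.{v}) [Subsingleton (F.H 1)] (f : F.obj.obj (op S.X₁)) :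
    ∃ (a : F.obj.obj (op S.X₂)) (b : F.obj.obj (op S.X₃)),
      F.obj.map S.f₁₂.op a - F.obj.map S.f₁₃.op b = f := by
  let e : (constantSheaf J AddCommGrpCat.{v}).obj (AddCommGrpCat.of (ULift ℤ)) ≅
      S.shortComplex.X₃ :=
    (presheafToSheaf _ _).mapIso (freeYonedaTerminalIso hS).symm
  let g : S.shortComplex.X₁ ⟶ F := (freeYonedaHomEquiv S.X₁ F).symm f
  -- The free abelian sheaf on a final object is the constant sheaf `ℤ`, so `H¹` is this `Ext¹`.
  have hsub (x : Ext S.shortComplex.X₃ F 1) : x = 0 := by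
    have h : (Ext.mk₀ e.hom).comp x (zero_add 1) = 0 := Subsingleton.elim (α := F.H 1) _ _
    rw [← Ext.mk₀_id_comp x, ← e.inv_hom_id, ← Ext.mk₀_comp_mk₀_assoc, h, Ext.comp_zero]
  obtain ⟨k, hk⟩ := Ext.contravariant_sequence_exact₁ S.shortComplex_shortExact F (Ext.mk₀ g)
    (add_zero 1) (hsub _)
  obtain ⟨k, rfl⟩ := (Ext.mk₀_bijective _ _).2 k
  rw [Ext.mk₀_comp_mk₀] at hk
  have hk := (Ext.mk₀_bijective _ _).1 hk
  refine ⟨freeYonedaHomEquiv S.X₂ F (Limits.biprod.inl ≫ k),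
    freeYonedaHomEquiv S.X₃ F (Limits.biprod.inr ≫ k), ?_⟩
  rw [← freeYonedaHomEquiv_comp, ← freeYonedaHomEquiv_comp, sub_eq_iff_eq_add,
    ← (freeYonedaHomEquiv S.X₁ F).apply_symm_apply f, ← freeYonedaHomEquiv_add]
  congr 1
  rw [← sub_eq_iff_eq_add]
  refine Eq.trans ?_ hk
  exact (biprod_lift_neg_comp _ _ k).symm

end Site

/-- The Mayer–Vietoris square of a cover of a topological space by two open sets. -/
noncomputable abbrev coverSquare {Y : TopCat.{0}} {U V : Opens Y} (hUV : U ⊔ V = ⊤) :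
    (Opens.grothendieckTopology Y).MayerVietorisSquare :=
  Opens.mayerVietorisSquare' (T := Y)
    { X₁ := U ⊓ V
      X₂ := U
      X₃ := V
      X₄ := ⊤
      f₁₂ := homOfLE inf_le_left
      f₁₃ := homOfLE inf_le_right
      f₂₄ := homOfLE le_top
      f₃₄ := homOfLE le_top
      fac := Subsingleton.elim _ _ } hUV.symm rfl

theorem exists_sub_of_subsingleton_cohomology_one {Y : TopCat.{0}}
    (h : Subsingleton (cohomology (contSheaf Y) 1)) {U V : Opens Y} (hUV : U ⊔ V = ⊤)
    (f : C((U ⊓ V : Opens Y), ℝ)) :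
    ∃ (a : C(U, ℝ)) (b : C(V, ℝ)), ∀ (y : Y) (hU : y ∈ U) (hV : y ∈ V),
      a ⟨y, hU⟩ - b ⟨y, hV⟩ = f ⟨y, hU, hV⟩ := by
  obtain ⟨a, b, hab⟩ := exists_sub_of_subsingleton_H_one (coverSquare hUV) Limits.isTerminalTop
    (contSheaf Y) f
  exact ⟨a, b, fun y hU hV => DFunLike.congr_fun (F := C((U ⊓ V : Opens Y), ℝ)) hab ⟨y, hU, hV⟩⟩

/-! ### Softness and a cover by two open sets -/

/-- Restriction of continuous functions along a continuous map, as a morphism of sheaves. -/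
def contSheafPullback {A Y : TopCat.{0}} (i : A ⟶ Y) :
    contSheaf Y ⟶ (TopCat.Sheaf.pushforward AddCommGrpCat.{0} i).obj (contSheaf A) :=
  ⟨{ app U := AddCommGrpCat.ofHom (ContinuousMap.compAddMonoidHom'
      (⟨fun a => ⟨i a.1, a.2⟩, by fun_prop⟩ : C((Opens.map i).obj U.unop, U.unop)))
     naturality _ _ _ := rfl }⟩

/-- Let `A` be the complement of `U ⊓ V`. As `U` and `V` are disjoint on `A`, the section `0` over
`U` and the section `1` over `V` glue to a section of the inverse image sheaf over `A`. Softness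
extends it to `Y`. The values of the extension on `A` are read off from the comparison map `c` from
the inverse image sheaf to the sheaf of continuous functions on `A`. -/
theorem exists_extension_of_isSoft {Y : TopCat.{0}} (hY : IsSoft (contSheaf Y))
    {U V : Opens Y} (hUV : U ⊔ V = ⊤) :
    ∃ g : C(Y, ℝ), (∀ y, y ∉ V → g y = 0) ∧ ∀ y, y ∉ U → g y = 1 := by
  have hmem (y : Y) : y ∈ U ∨ y ∈ V := by
    have : y ∈ U ⊔ V := by rw [hUV]; trivial
    exact this
  let A : Set Y := ((U ⊓ V : Opens Y) : Set Y)ᶜ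
  let i : TopCat.of A ⟶ Y := TopCat.ofHom (⟨Subtype.val, continuous_subtype_val⟩ : C(A, Y))
  let adj := TopCat.Sheaf.pullbackPushforwardAdjunction AddCommGrpCat.{0} i
  let P := (TopCat.Sheaf.pullback AddCommGrpCat.{0} i).obj (contSheaf Y)
  let η := adj.unit.app (contSheaf Y)
  let c : P ⟶ contSheaf (TopCat.of A) := (adj.homEquiv _ _).symm (contSheafPullback i)
  have hc (W : Opens Y) (s : (contSheaf Y).obj.obj (op W)) :
      c.hom.app (op ((Opens.map i).obj W)) (η.hom.app (op W) s) =
        (contSheafPullback i).hom.app (op W) s := by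
    have h := (adj.homEquiv _ _).apply_symm_apply (contSheafPullback i)
    rw [Adjunction.homEquiv_unit] at h
    rw [← h]
    rfl
  let s₀ : P.obj.obj (op ((Opens.map i).obj U)) := η.hom.app (op U) (0 : C(U, ℝ))
  let s₁ : P.obj.obj (op ((Opens.map i).obj V)) := η.hom.app (op V) (1 : C(V, ℝ))
  obtain ⟨s, hs₀, hs₁⟩ : ∃ s : P.obj.obj (op ⊤),
      P.obj.map (homOfLE le_top : (Opens.map i).obj U ⟶ ⊤).op s = s₀ ∧
      P.obj.map (homOfLE le_top : (Opens.map i).obj V ⟶ ⊤).op s = s₁ := by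
    have hcover : (⊤ : Opens (TopCat.of A)) ≤
        ⨆ b : Bool, cond b ((Opens.map i).obj U) ((Opens.map i).obj V) := by
      intro a _
      rcases hmem a.1 with h | h
      · exact Opens.mem_iSup.2 ⟨true, h⟩
      · exact Opens.mem_iSup.2 ⟨false, h⟩
    have hempty (W : Opens (TopCat.of A))
        (hW : W ≤ (Opens.map i).obj U ⊓ (Opens.map i).obj V) : Subsingleton (P.obj.obj (op W)) :=
      AddCommGrpCat.subsingleton_of_isZero
        ((Limits.isZero_zero _).of_iso ((TopCat.Sheaf.isTerminalOfEqEmpty P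
          (le_bot_iff.1 fun a ha => a.2 (hW ha))).uniqueUpToIso Limits.HasZeroObject.zeroIsTerminal))
    obtain ⟨s, hs, -⟩ := TopCat.Sheaf.existsUnique_gluing' P
      (fun b : Bool => cond b ((Opens.map i).obj U) ((Opens.map i).obj V)) ⊤
      (fun b => homOfLE le_top) hcover (fun b => match b with | true => s₀ | false => s₁) (by
        rintro (_ | _) (_ | _)
        · rfl
        · exact (hempty _ (inf_comm _ _).le).elim _ _
        · exact (hempty _ le_rfl).elim _ _
        · rfl)
    exact ⟨s, hs true, hs false⟩
  obtain ⟨g, rfl⟩ := hY A (U ⊓ V).isOpen.isClosed_compl s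
  -- If `g` and `s` agree in the inverse image sheaf over `W`, then they agree as functions
  -- on `W ∩ A`.
  have key (W : Opens Y) (s : (contSheaf Y).obj.obj (op W))
      (h : P.obj.map (homOfLE le_top : (Opens.map i).obj W ⟶ ⊤).op
        (η.hom.app (op ⊤) g) = η.hom.app (op W) s) :
      (contSheafPullback i).hom.app (op W)
          ((contSheaf Y).obj.map (homOfLE le_top : W ⟶ ⊤).op g) =
        (contSheafPullback i).hom.app (op W) s := by
    rw [← hc, ← hc, ← h]
    congr 1
    exact ConcreteCategory.congr_hom (η.hom.naturality (homOfLE le_top : W ⟶ ⊤).op) g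
  have h₀ := key U _ hs₀
  have h₁ := key V _ hs₁
  refine ⟨(g : C((⊤ : Opens Y), ℝ)).comp ⟨fun y => ⟨y, trivial⟩, by fun_prop⟩,
    fun y hy => ?_, fun y hy => ?_⟩
  · exact DFunLike.congr_fun (F := C((Opens.map i).obj U, ℝ)) h₀
      ⟨⟨y, fun h => hy h.2⟩, (hmem y).resolve_right hy⟩
  · exact DFunLike.congr_fun (F := C((Opens.map i).obj V, ℝ)) h₁
      ⟨⟨y, fun h => hy h.1⟩, (hmem y).resolve_left hy⟩

/-! ### A height function on the CW-complex -/

/-- A function on the circle with values in `[0, 1]` extends to the disk in such a way that the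
value `1` is only taken on the boundary: multiply a Tietze extension by the norm. -/
theorem Disk.exists_extension (g : C(Circle, ℝ)) (hg : ∀ z, g z ∈ Set.Icc (0 : ℝ) 1) :
    ∃ G : C(Disk, ℝ), (∀ z, G (Disk.ofCircle z) = g z) ∧ (∀ z, G z ≤ 1) ∧
      ∀ z, G z = 1 → z ∈ Set.range Disk.ofCircle := by
  have hcont : Continuous Disk.ofCircle := by unfold Disk.ofCircle; fun_prop
  have hinj : Function.Injective Disk.ofCircle := fun z w h =>
    Circle.ext (congrArg (fun p : Disk => (p : ℂ)) h)
  obtain ⟨G, hG, hGg⟩ := g.exists_extension_forall_mem_of_isClosedEmbedding (t := Set.Icc 0 1) hg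
    ⟨0, by simp⟩ (hcont.isClosedEmbedding hinj)
  have hnorm (z : Disk) : ‖(z : ℂ)‖ ≤ 1 := mem_closedBall_zero_iff.1 z.2
  refine ⟨⟨fun z => ‖(z : ℂ)‖ * G z, by fun_prop⟩, fun z => ?_, fun z => ?_, fun z hz => ?_⟩
  · have h : G (Disk.ofCircle z) = g z := congrFun hGg z
    have h' : ‖(Disk.ofCircle z : ℂ)‖ = 1 := Circle.norm_coe z
    simp [h, h']
  · exact mul_le_one₀ (hnorm z) (hG z).1 (hG z).2
  · have h1 : ‖(z : ℂ)‖ * G z = 1 := hz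
    have h2 : ‖(z : ℂ)‖ = 1 := by
      nlinarith [hnorm z, (hG z).1, (hG z).2, norm_nonneg (z : ℂ)]
    exact ⟨⟨z, mem_sphere_zero_iff_norm.2 h2⟩, rfl⟩

theorem loop_cases {n : ℕ+} {q : OneSkeleton} (hq : q ∈ loop n) :
    q = OneSkeleton.vertex 0 ∨ q = OneSkeleton.vertex n ∨
      ∃ b t, q = OneSkeleton.edge n b t := by
  rcases hq with (rfl | rfl) | (⟨t, rfl⟩ | ⟨t, rfl⟩)
  exacts [Or.inl rfl, Or.inr (Or.inl rfl), Or.inr (Or.inr ⟨_, _, rfl⟩), Or.inr (Or.inr ⟨_, _, rfl⟩)]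

theorem OneSkeleton.edge_one (n : ℕ+) (b : Bool) : edge n b 1 = vertex n :=
  Quot.sound (EdgeGlue.target (n, b))

/-- The function on the 1-skeleton which vanishes at `e₀⁰`, is `1` at the other 0-cells, and is the
parameter along each 1-cell. -/
def OneSkeleton.height : C(OneSkeleton, ℝ) where
  toFun := Quot.lift (Sum.elim (fun n => if n = 0 then 0 else 1) fun p => (p.2 : ℝ)) <| by
    rintro _ _ (k | k) <;> simp
  continuous_toFun := by
    refine continuous_coinduced_dom.2 (continuous_sum_dom.2 ⟨?_, ?_⟩)
    · exact continuous_of_discreteTopology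
    · exact continuous_sigma fun k => continuous_subtype_val

theorem OneSkeleton.height_vertex_zero : height (vertex 0) = 0 :=
  show (if (0 : ℕ) = 0 then (0 : ℝ) else 1) = 0 from if_pos rfl

theorem OneSkeleton.height_vertex (n : ℕ+) : height (vertex n) = 1 :=
  show (if (n : ℕ) = 0 then (0 : ℝ) else 1) = 1 from if_neg n.ne_zero

theorem OneSkeleton.height_edge (n : ℕ+) (b : Bool) (t : unitInterval) :
    height (edge n b t) = t := rfl

theorem height_mem_Icc {n : ℕ+} {q : OneSkeleton} (hq : q ∈ loop n) :
    OneSkeleton.height q ∈ Set.Icc (0 : ℝ) 1 := by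
  rcases loop_cases hq with rfl | rfl | ⟨b, t, rfl⟩
  · simp [OneSkeleton.height_vertex_zero]
  · simp [OneSkeleton.height_vertex]
  · exact t.2

theorem eq_vertex_of_height_eq_one {n : ℕ+} {q : OneSkeleton} (hq : q ∈ loop n)
    (h : OneSkeleton.height q = 1) : q = OneSkeleton.vertex n := by
  rcases loop_cases hq with rfl | rfl | ⟨b, t, rfl⟩
  · simp [OneSkeleton.height_vertex_zero] at h
  · rfl
  · rw [OneSkeleton.height_edge] at h
    rw [Subtype.ext (a1 := t) (a2 := 1) h, OneSkeleton.edge_one]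

/-! ### Continuous functions for the coarser topology -/

/-- The identity of `X`, from the CW-topology to the coarser topology. -/
def toCrs (φ : AttachingMaps) (p : CW φ) : Crs φ := p

theorem continuous_toCrs (φ : AttachingMaps) : Continuous (toCrs φ) := by
  refine continuous_def.2 fun U hU => ?_
  have h : IsCoarseOpen φ U := hU
  exact h.1

/-- The 1-cell with index `n` and `b = true`, as a path from the origin to `eₙ⁰`. -/
def edgePath (φ : AttachingMaps) (n : ℕ+) : C(unitInterval, Crs φ) where
  toFun t := toCrs φ (Quot.mk _ (Sum.inl (OneSkeleton.edge n true t)))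
  continuous_toFun := (continuous_toCrs φ).comp <| continuous_quot_mk.comp <| continuous_inl.comp <|
    continuous_quot_mk.comp <| continuous_inr.comp <|
      continuous_sigmaMk (σ := fun _ : ℕ+ × Bool => unitInterval) (i := (n, true))

theorem edgePath_one (φ : AttachingMaps) (n : ℕ+) : edgePath φ n 1 = vertex φ n :=
  congrArg (fun q => (Quot.mk _ (Sum.inl q) : CW φ)) (OneSkeleton.edge_one n true)

/-- This 1-cell lies on the `n`-th closed 2-cell, because `φₙ` is surjective. -/
theorem edgePath_mem_closedCell (φ : AttachingMaps) (n : ℕ+) (t : unitInterval) :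
    edgePath φ n t ∈ closedCell φ n := by
  obtain ⟨z, hz⟩ := (φ n).surjective ⟨OneSkeleton.edge n true t, Or.inr (Or.inl ⟨t, rfl⟩)⟩
  refine ⟨Disk.ofCircle z, (Quot.sound (DiskGlue.glue n z)).trans ?_⟩
  rw [hz]
  rfl

/-- The height extends continuously from the 1-skeleton to `X` (for the CW-topology). On the `n`-th
closed 2-cell the extension is at most `1`, with equality only at the 0-cell `eₙ⁰`. -/
theorem exists_height (φ : AttachingMaps) : ∃ h : C(CW φ, ℝ),
    h (origin φ) = 0 ∧ (∀ n t, h (edgePath φ n t) = t) ∧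
      ∀ n : ℕ+, ∀ p ∈ closedCell φ n, h p ≤ 1 ∧ (h p = 1 → p = vertex φ n) := by
  have (n : ℕ+) := Disk.exists_extension
    (OneSkeleton.height.comp ⟨fun z => (φ n z : OneSkeleton), by fun_prop⟩)
    fun z => height_mem_Icc (φ n z).2
  choose G hG hG1 hGr using this
  let h : C(CW φ, ℝ) :=
    { toFun := Quot.lift (Sum.elim OneSkeleton.height fun p => G p.1 p.2) <| by
        rintro _ _ ⟨n, z⟩
        exact hG n z
      continuous_toFun := continuous_coinduced_dom.2 (continuous_sum_dom.2
        ⟨OneSkeleton.height.continuous, continuous_sigma fun n => (G n).continuous⟩) }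
  refine ⟨h, OneSkeleton.height_vertex_zero, fun n t => OneSkeleton.height_edge n true t, ?_⟩
  rintro n _ ⟨z, rfl⟩
  refine ⟨hG1 n z, fun hz => ?_⟩
  obtain ⟨w, rfl⟩ := hGr n z hz
  have hw : OneSkeleton.height (φ n w) = 1 := (hG n w).symm.trans hz
  refine (Quot.sound (DiskGlue.glue n w)).trans ?_
  rw [eq_vertex_of_height_eq_one (φ n w).2 hw]
  rfl

/-- On an open set that misses the origin, continuity for the CW-topology is enough. -/
theorem continuous_restrict_of_origin_notMem (φ : AttachingMaps) (V : Opens (Crs φ))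
    (hV : origin φ ∉ V) {g : CW φ → ℝ} (hg : ContinuousOn g (V : Set (Crs φ))) :
    Continuous fun p : V => g p.1 := by
  refine continuous_def.2 fun O hO => isOpen_induced_iff.2
    ⟨{p | p ∈ V ∧ g p ∈ O}, ⟨hg.isOpen_inter_preimage V.isOpen.1 hO, Or.inl fun h => hV h.1⟩, ?_⟩
  ext p
  simp

theorem isOpen_setOf_abs_sub_lt {Y : Type*} [TopologicalSpace Y] (U : Opens Y) (u : C(U, ℝ))
    (c ε : ℝ) : IsOpen {p : Y | ∃ hp : p ∈ U, |u ⟨p, hp⟩ - c| < ε} := by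
  have h : IsOpen {p : U | |u p - c| < ε} := isOpen_lt (by fun_prop) continuous_const
  convert U.isOpen.isOpenMap_subtype_val _ h
  ext p
  simp [and_comm]

/-- A function that is continuous at the origin for the coarser topology is nearly constant on
almost all punctured cells `closedCell φ n \ {vertex φ n}`, in particular on one of the half-open
1-cells. -/
theorem exists_forall_abs_sub_lt (φ : AttachingMaps) (U : Opens (Crs φ)) (hU : origin φ ∈ U)
    (u : C(U, ℝ)) {ε : ℝ} (hε : 0 < ε) :
    ∃ n : ℕ+, ∀ t < 1, ∃ ht : edgePath φ n t ∈ U,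
      |u ⟨edgePath φ n t, ht⟩ - u ⟨origin φ, hU⟩| < ε := by
  have hW := isOpen_setOf_abs_sub_lt U u (u ⟨origin φ, hU⟩) ε
  have hfin := hW.2.resolve_left fun h => h ⟨hU, by simpa⟩
  -- Only finitely many indices are excluded, so some index `n` remains.
  obtain ⟨n, hn⟩ := hfin.infinite_compl.nonempty
  refine ⟨n, fun t ht => not_not.1 hn ⟨edgePath_mem_closedCell φ n t, fun hv => ht.ne ?_⟩⟩
  obtain ⟨h, -, he, -⟩ := exists_height φ
  have h1 := he n 1
  rw [edgePath_one, ← show edgePath φ n t = vertex φ n from hv, he] at h1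
  exact Subtype.ext h1

/-- The two sets where the height is less than `1`, respectively greater than `1/2`, cover `X`. Both
are open for the coarser topology: the first contains all closed 2-cells with the 0-cells `eₙ⁰`
removed, and the second misses the origin. -/
theorem exists_cover (φ : AttachingMaps) : ∃ (h : CW φ → ℝ) (U V : Opens (Crs φ)),
    Continuous h ∧ (∀ n t, h (edgePath φ n t) = t) ∧ (∀ p, p ∈ U ↔ h p < 1) ∧
      (∀ p, p ∈ V ↔ 1 / 2 < h p) ∧ U ⊔ V = ⊤ ∧ origin φ ∈ U ∧ origin φ ∉ V := by
  obtain ⟨h, h0, he, hc⟩ := exists_height φ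
  let U : Opens (Crs φ) := ⟨{p | h p < 1}, isOpen_lt h.continuous continuous_const, Or.inr <| by
    refine Set.finite_empty.subset fun n hn => hn fun p hp => ?_
    exact lt_of_le_of_ne (hc n p hp.1).1 fun h1 => hp.2 ((hc n p hp.1).2 h1)⟩
  have h0V : origin φ ∉ {p : CW φ | 1 / 2 < h p} := by simp [h0]
  let V : Opens (Crs φ) :=
    ⟨{p | 1 / 2 < h p}, isOpen_lt continuous_const h.continuous, Or.inl h0V⟩
  refine ⟨h, U, V, h.continuous, he, fun _ => Iff.rfl, fun _ => Iff.rfl, ?_, ?_, h0V⟩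
  · refine top_le_iff.1 fun p _ => ?_
    rcases lt_or_ge (h p) 1 with hp | hp
    · exact Or.inl hp
    · exact Or.inr (show 1 / 2 < h p by linarith)
  · show h (origin φ) < 1
    simp [h0]

/-! ### Cohomology and softness of the sheaf of continuous functions -/

/-- If `v` is continuous near `eₙ⁰`, then some point `t < 1` of the 1-cell is as close to `1` as
desired and has `v` close to its value at `eₙ⁰`. -/
theorem exists_lt_one_abs_sub_lt (φ : AttachingMaps) (n : ℕ+) (V : Opens (Crs φ))
    (hV : edgePath φ n 1 ∈ V) (v : C(V, ℝ)) {ε : ℝ} (hε : 0 < ε) {a : ℝ} (ha : a < 1) :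
    ∃ t : unitInterval, t < 1 ∧ a < t ∧ ∃ ht : edgePath φ n t ∈ V,
      |v ⟨edgePath φ n t, ht⟩ - v ⟨edgePath φ n 1, hV⟩| < ε := by
  have hW := isOpen_setOf_abs_sub_lt V v (v ⟨edgePath φ n 1, hV⟩) ε
  have hN := (hW.preimage (edgePath φ n).continuous).inter
    (isOpen_lt (continuous_const (y := a)) continuous_subtype_val)
  have : (nhdsWithin (1 : unitInterval) (Set.Iio 1)).NeBot :=
    nhdsLT_neBot_of_exists_lt ⟨0, zero_lt_one⟩
  obtain ⟨t, ⟨ht, hat⟩, ht1⟩ := Filter.nonempty_of_mem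
    (f := nhdsWithin (1 : unitInterval) (Set.Iio 1))
    (Filter.inter_mem (mem_nhdsWithin_of_mem_nhds (hN.mem_nhds ⟨⟨hV, by simpa⟩, ha⟩))
      self_mem_nhdsWithin)
  exact ⟨t, ht1, hat, ht⟩

theorem not_subsingleton_cohomology_one (φ : AttachingMaps) :
    ¬ Subsingleton (cohomology (contSheaf (TopCat.of (Crs φ))) 1) := by
  intro hH
  obtain ⟨h, U, V, hcont, he, hU, hV, hUV, hxU, hxV⟩ := exists_cover φ
  -- The function `1 / (1 - h)` on `U ⊓ V` is unbounded near each 0-cell `eₙ⁰` with `n ≥ 1`.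
  have hg : ContinuousOn (fun p : CW φ => (1 - h p)⁻¹) ((U ⊓ V : Opens (Crs φ)) : Set (Crs φ)) :=
    (continuous_const.sub hcont).continuousOn.inv₀ fun p hp =>
      (sub_pos.2 ((hU p).1 hp.1)).ne'
  obtain ⟨u, v, huv⟩ := exists_sub_of_subsingleton_cohomology_one hH hUV
    ⟨_, continuous_restrict_of_origin_notMem φ (U ⊓ V) (fun hx => hxV hx.2) hg⟩
  obtain ⟨n, hn⟩ := exists_forall_abs_sub_lt φ U hxU u one_pos
  have h1V : edgePath φ n 1 ∈ V := (hV _).2 (by rw [he]; norm_num)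
  -- On the 1-cell, `u - v` stays below `M` near `eₙ⁰`.
  obtain ⟨M, hM⟩ : ∃ M, M = |u ⟨origin φ, hxU⟩| + |v ⟨edgePath φ n 1, h1V⟩| + 2 := ⟨_, rfl⟩
  have hM0 : 0 < M := by rw [hM]; positivity
  obtain ⟨t, ht1, hMt, htV, hv⟩ := exists_lt_one_abs_sub_lt φ n V h1V v one_pos
    (a := 1 - M⁻¹) (sub_lt_self 1 (inv_pos.2 hM0))
  obtain ⟨htU, hu⟩ := hn t ht1
  have key : u ⟨edgePath φ n t, htU⟩ - v ⟨edgePath φ n t, htV⟩ = (1 - (t : ℝ))⁻¹ := by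
    rw [← he n t]
    exact huv _ htU htV
  have ht1' : (0 : ℝ) < 1 - t := sub_pos.2 ht1
  have hlarge : M < (1 - (t : ℝ))⁻¹ := by
    rw [lt_inv_comm₀ hM0 ht1']
    linarith
  have := abs_lt.1 hu
  have := abs_lt.1 hv
  have := le_abs_self (u ⟨origin φ, hxU⟩)
  have := neg_abs_le (v ⟨edgePath φ n 1, h1V⟩)
  linarith

/-- A global function which is `0` at the origin and `1` at every `eₙ⁰` with `n ≥ 1` is not
continuous for the coarser topology, although softness would provide one. -/
theorem not_isSoft (φ : AttachingMaps) : ¬ IsSoft (contSheaf (TopCat.of (Crs φ))) := by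
  intro hsoft
  obtain ⟨h, U, V, -, he, hU, -, hUV, hxU, hxV⟩ := exists_cover φ
  obtain ⟨g, hg0, hg1⟩ := exists_extension_of_isSoft hsoft hUV
  let g' : C((⊤ : Opens (Crs φ)), ℝ) := ⟨fun p => g p.1, g.continuous.comp continuous_subtype_val⟩
  obtain ⟨n, hn⟩ := exists_forall_abs_sub_lt φ ⊤ trivial g' one_half_pos
  obtain ⟨t, ht1, -, htV, hv⟩ :=
    exists_lt_one_abs_sub_lt φ n ⊤ trivial g' one_half_pos zero_lt_one
  obtain ⟨_, hu⟩ := hn t ht1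
  have h0 : g (origin φ) = 0 := hg0 _ hxV
  have h1 : g (edgePath φ n 1) = 1 := hg1 _ fun hp => by
    have := (hU _).1 hp
    rw [he] at this
    exact lt_irrefl _ this
  have hu : |g (edgePath φ n t) - g (origin φ)| < 1 / 2 := hu
  have hv : |g (edgePath φ n t) - g (edgePath φ n 1)| < 1 / 2 := hv
  rw [h0, abs_lt] at hu
  rw [h1, abs_lt] at hv
  linarith

end CoarseCW

theorem mainTheorem3 (φ : CoarseCW.AttachingMaps) :
    Nontrivial (CoarseCW.cohomology (CoarseCW.contSheaf (TopCat.of (CoarseCW.Crs φ))) 1) ∧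
      ¬ CoarseCW.IsSoft (CoarseCW.contSheaf (TopCat.of (CoarseCW.Crs φ))) ∧
      ¬ CoarseCW.IsAcyclic (CoarseCW.contSheaf (TopCat.of (CoarseCW.Crs φ))) := by
  have h := CoarseCW.not_subsingleton_cohomology_one φ
  exact ⟨not_subsingleton_iff_nontrivial.1 h, CoarseCW.not_isSoft φ, fun ha => h (ha 1 one_pos)⟩
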